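/- All rings and algebras are associative; let $\Phi$ be a commutative ring with $1$, and let $A$ be a $\Phi$-algebra with $1$. Call $A$ a PI-algebra if there are $n\ge 1$ and coefficients $\alpha_\sigma\in\Phi$ ($1\ne\sigma\in S_n$) such that $a_1\cdots a_n+\sum_{1\neq\sigma\in S_n}\alpha_\sigma a_{\sigma(1)}\cdots a_{\sigma(n)}=0$ for all $a_1,\dots,a_n\in A$. Call $A$ representable if for some $n$ and some commutative $\Phi$-algebra $C$ there is an injective homomorphism of $\Phi$-algebras $A\to M_n(C)$ (not required to preserve $1$). A group is virtually torsion free if it has a subgroup of finite index in which the identity is the only element of finite order. Theorem. Let $A$ be a finitely generated representable PI-algebra over a commutative ring $\Phi$, and suppose that the additive group of $A$ is torsion free. Then: (a) every finitely generated subgroup of the group $\mathrm{Aut}_\Phi(A)$ of $\Phi$-algebra automorphisms of $A$ is virtually torsion free; (b) if $A$ is finitely generated as a ring, then the group $\mathrm{Aut}(A)$ of all ring automorphisms of $A$ is virtually torsion free. -/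

import Mathlib

universe u v w

/-- A group is virtually torsion free if it has a subgroup of finite index in which the identity is
the only element of finite order. (For non-abelian groups Mathlib's `IsMulTorsionFree` is the
stronger property of uniqueness of roots, so it is not used here.) -/
def IsVirtuallyTorsionFree (G : Type*) [Group G] : Prop :=
  ∃ K : Subgroup G, K.FiniteIndex ∧ ∀ g ∈ K, IsOfFinOrder g → g = 1

/-- The multilinear element `∑ σ, α σ • x_{σ 1} ⋯ x_{σ n}` of the free associative algebra
`Φ⟨x_1, …, x_n⟩`. -/
noncomputable def multilinearElement {Φ : Type u} [CommRing Φ] {n : ℕ}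
    (α : Equiv.Perm (Fin n) → Φ) : FreeAlgebra Φ (Fin n) :=
  ∑ σ : Equiv.Perm (Fin n), α σ • (List.ofFn fun i => FreeAlgebra.ι Φ (σ i)).prod

/-- `A` is a PI-algebra over `Φ`: for some `n ≥ 1` it satisfies an identity
`x_1 ⋯ x_n + ∑_{σ ≠ 1} α_σ x_{σ 1} ⋯ x_{σ n} = 0` with coefficients in `Φ`. -/
def IsPIAlgebra (Φ : Type u) (A : Type v) [CommRing Φ] [Ring A] [Algebra Φ A] : Prop :=
  ∃ n : ℕ, 1 ≤ n ∧ ∃ α : Equiv.Perm (Fin n) → Φ, α 1 = 1 ∧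
    ∀ a : Fin n → A, FreeAlgebra.lift Φ a (multilinearElement α) = 0

/-- `A` is representable: it embeds, as a `Φ`-algebra, in the algebra of `n × n` matrices over a
commutative `Φ`-algebra `C`. The embedding need not send `1` to the identity matrix. -/
def IsRepresentable (Φ : Type u) (A : Type v) [CommRing Φ] [Ring A] [Algebra Φ A] : Prop :=
  ∃ (C : Type w) (_ : CommRing C) (_ : Algebra Φ C) (n : ℕ)
    (f : A →ₙₐ[Φ] Matrix (Fin n) (Fin n) C), Function.Injective f

/-!
Part (a) is reduced to part (b). Let `S` generate `A` over `Φ`, and let `H` be a finitely generated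
group of automorphisms. The images of `S` under the generators of `H` and their inverses involve
finitely many coefficients from `Φ`; together with `S` these generate an `H`-invariant subring, on
which `H` acts faithfully because it generates `A` over `Φ`
(`exists_invariant_finiteType_subring`). It remains to treat a group `G` acting faithfully on a
finitely generated torsion-free ring `A` embedded in `Mₙ(C)` (`isVirtuallyTorsionFree_of_matrix`),
where `C` may be taken torsion free (invert the nonzero integers) and finitely generated over `ℤ`
(adjoin only the matrix entries of generators).

For all but finitely many primes `l` there is a homomorphism `q` from such a `C` to a finite ring
`R` of characteristic dividing `l` with `⋂ (ker q) ^ k = 0`: every associated prime of `C` has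
residue characteristic zero, hence lies in a maximal ideal containing `l` for almost all `l`, and
Krull's intersection theorem applies to the intersection of these maximal ideals
(`exists_finite_quotient_iInf_pow_ker_eq_bot`).

Automorphisms of `A` need not extend to `C`, so let `I` be the intersection of the kernels of *all*
homomorphisms `A → Mₙ(R)`. There are finitely many of them, and `G` permutes them, so `I` is an
invariant ideal of finite index containing `l`, and `⋂ I ^ k = 0` since `I ^ k` lies in
`Mₙ((ker q) ^ k)`. As `A` is finitely generated, `I ^ 2` has finite index too
(`fg_quotient_mul_self`). If `g` acts trivially on `A ⧸ I ^ 2`, then it acts trivially on every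
`I ^ k ⧸ I ^ (k + 1)`; if moreover `g ^ p = 1` with `p` prime to `l`, then `g a - a ∈ I ^ k` for
all `k` by induction, since on `A ⧸ I ^ (k + 1)` the `p`-th power of `g` translates `a` by
`p • (g a - a)` and `p` is invertible there (`smul_sub_mem_pow_of_pow_eq_one`). Hence `g = 1`, and
the kernel of the action on `A ⧸ I ^ 2` has no torsion of order prime to `l`. Intersecting these
kernels for two different `l` removes all torsion.
-/

/-! ### Finite quotients of finitely generated commutative rings -/

/-- All but finitely many primes are non-units in `D`: being torsion free, `D` is flat over `ℤ`, so the
image of `Spec D → Spec ℤ` is open, and it is nonempty. -/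
theorem exists_forall_prime_not_isUnit (D : Type*) [CommRing D] [IsDomain D] [CharZero D]
    [Algebra.FiniteType ℤ D] :
    ∃ N : ℤ, N ≠ 0 ∧ ∀ l : ℕ, l.Prime → ¬ (l : ℤ) ∣ N → ¬ IsUnit (l : D) := by
  have hopen : IsOpen (Set.range (PrimeSpectrum.comap (algebraMap ℤ D))) := by
    have : Algebra.FinitePresentation ℤ D :=
      Algebra.FinitePresentation.of_finiteType.mp inferInstance
    exact (PrimeSpectrum.isOpenMap_comap_of_hasGoingDown_of_finitePresentation
      (R := ℤ) (S := D)).isOpen_range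
  obtain ⟨s, hs⟩ := (PrimeSpectrum.isOpen_iff _).mp hopen
  have hp : PrimeSpectrum.comap (algebraMap ℤ D) ⊥ ∉
      (Set.range (PrimeSpectrum.comap (algebraMap ℤ D)))ᶜ := fun h => h ⟨_, rfl⟩
  rw [hs, PrimeSpectrum.mem_zeroLocus, Set.not_subset] at hp
  obtain ⟨N, hN, hN0⟩ := hp
  refine ⟨N, fun h => hN0 (h ▸ Ideal.zero_mem _), fun l hl hlN hu => ?_⟩
  have hlp : (Ideal.span {(l : ℤ)}).IsPrime :=
    (Ideal.span_singleton_prime (by exact_mod_cast hl.ne_zero)).mpr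
      (Nat.prime_iff_prime_int.mp hl)
  have hmem : (⟨Ideal.span {(l : ℤ)}, hlp⟩ : PrimeSpectrum ℤ) ∉
      (Set.range (PrimeSpectrum.comap (algebraMap ℤ D)))ᶜ := by
    rw [hs, PrimeSpectrum.mem_zeroLocus]
    exact fun h => hlN (Ideal.mem_span_singleton.mp (h hN))
  obtain ⟨Q, hQ⟩ := not_not.mp hmem
  have hlQ : (l : ℤ) ∈ (PrimeSpectrum.comap (algebraMap ℤ D) Q).asIdeal := by
    rw [hQ]; exact Ideal.mem_span_singleton_self _
  have hlQ' : (l : D) ∈ Q.asIdeal := by simpa using hlQ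
  exact Q.isPrime.ne_top (Ideal.eq_top_of_isUnit_mem _ hlQ' hu)

/-- By Zariski's lemma `C ⧸ m` is a finite extension of `ZMod l`. -/
theorem finite_quotient_of_isMaximal {C : Type*} [CommRing C] [Algebra.FiniteType ℤ C]
    (m : Ideal C) [m.IsMaximal] {l : ℕ} (hl : l.Prime) (hlm : (l : C) ∈ m) : Finite (C ⧸ m) := by
  have := Fact.mk hl
  let _ : Field (C ⧸ m) := Ideal.Quotient.field m
  have h0 : (l : C ⧸ m) = 0 := by
    simpa using Ideal.Quotient.eq_zero_iff_mem.mpr hlm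
  have : CharP (C ⧸ m) l := (CharP.charP_iff_prime_eq_zero hl).mpr h0
  let _ : Algebra (ZMod l) (C ⧸ m) := ZMod.algebra _ l
  have : IsScalarTower ℤ (ZMod l) (C ⧸ m) := IsScalarTower.of_algebraMap_eq' (Subsingleton.elim _ _)
  have : Algebra.FiniteType (ZMod l) (C ⧸ m) :=
    Algebra.FiniteType.of_restrictScalars_finiteType ℤ (ZMod l) (C ⧸ m)
  have := finite_of_finite_type_of_isJacobsonRing (ZMod l) (C ⧸ m)
  exact Module.finite_of_finite (ZMod l)

/-- For almost all primes `l`, a finitely generated torsion-free commutative ring is separated in the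
adic topology of some ideal of finite index containing `l`. -/
theorem exists_finite_quotient_iInf_pow_ker_eq_bot (C : Type w) [CommRing C]
    [Algebra.FiniteType ℤ C] [IsAddTorsionFree C] :
    ∃ N : ℤ, N ≠ 0 ∧ ∀ l : ℕ, l.Prime → ¬ (l : ℤ) ∣ N →
      ∃ (R : Type w) (_ : CommRing R) (g : C →+* R), Finite R ∧ (l : R) = 0 ∧
        ⨅ k : ℕ, RingHom.ker g ^ k = ⊥ := by
  have : IsNoetherianRing C := Algebra.FiniteType.isNoetherianRing ℤ C
  have hfin : Finite (associatedPrimes C C) := (associatedPrimes.finite C C).to_subtype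
  have key : ∀ P : associatedPrimes C C, ∃ N : ℤ, N ≠ 0 ∧ ∀ l : ℕ, l.Prime → ¬ (l : ℤ) ∣ N →
      ∃ m : Ideal C, m.IsMaximal ∧ P.1 ≤ m ∧ (l : C) ∈ m := by
    rintro ⟨P, hP⟩
    have hPp : P.IsPrime := hP.isPrime
    obtain ⟨x, hx⟩ := (isAssociatedPrime_iff.mp hP).2
    -- An integer in `P = ann x` kills `x ≠ 0`, so it is zero.
    have hchar : CharZero (C ⧸ P) := by
      refine charZero_of_inj_zero fun n hn => ?_
      by_contra hn0
      have hnP : (n : C) ∈ P := Ideal.Quotient.eq_zero_iff_mem.mp (by simpa using hn)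
      rw [hx, Submodule.mem_colon_singleton, Submodule.mem_bot, smul_eq_mul, ← nsmul_eq_mul] at hnP
      have hx0 : x = 0 := (nsmul_eq_zero_iff_right hn0).mp hnP
      exact hPp.ne_top (by rw [hx, hx0]; simp)
    have : Algebra.FiniteType ℤ (C ⧸ P) :=
      Algebra.FiniteType.of_surjective (Ideal.Quotient.mk P).toIntAlgHom
        Ideal.Quotient.mk_surjective
    obtain ⟨N, hN, h⟩ := @exists_forall_prime_not_isUnit (C ⧸ P) _ _ _ this
    refine ⟨N, hN, fun l hl hlN => ?_⟩
    obtain ⟨m, hm, hlm⟩ := exists_max_ideal_of_mem_nonunits (h l hl hlN)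
    refine ⟨m.comap (Ideal.Quotient.mk P),
      Ideal.comap_isMaximal_of_surjective _ Ideal.Quotient.mk_surjective, fun y hy => ?_, ?_⟩
    · rw [Ideal.mem_comap, Ideal.Quotient.eq_zero_iff_mem.mpr hy]
      exact m.zero_mem
    · simpa using hlm
  choose N hN hm using key
  have := Fintype.ofFinite (associatedPrimes C C)
  refine ⟨∏ P, N P, Finset.prod_ne_zero_iff.mpr fun P _ => hN P, fun l hl hlN => ?_⟩
  choose m hmax hle hlm using fun P => hm P l hl
    fun h => hlN (h.trans (Finset.dvd_prod_of_mem N (Finset.mem_univ P)))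
  have hQ : ∀ P, Finite (C ⧸ m P) := fun P => finite_quotient_of_isMaximal (m P) hl (hlm P)
  refine ⟨∀ P, C ⧸ m P, inferInstance, RingHom.pi fun P => Ideal.Quotient.mk (m P),
    inferInstance, ?_, ?_⟩
  · ext P
    simpa using Ideal.Quotient.eq_zero_iff_mem.mpr (hlm P)
  · set J := RingHom.ker (RingHom.pi fun P => Ideal.Quotient.mk (m P)) with hJ
    rw [eq_bot_iff]
    intro x hx
    have hx' : x ∈ (⨅ i : ℕ, J ^ i • ⊤ : Submodule C C) := by simpa using hx
    obtain ⟨r, hr⟩ := (Ideal.mem_iInf_smul_pow_eq_bot_iff J x).mp hx'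
    -- By Krull, `(1 - r) x = 0`; if `x ≠ 0`, then `1 - r` lies in an associated prime `P ⊆ m P`,
    -- whereas `r` lies in `m P`.
    by_contra hx0
    obtain ⟨P, hP, hxP⟩ := exists_le_isAssociatedPrime_of_isNoetherianRing C x hx0
    have h1 : 1 - (r : C) ∈ P := hxP (by
      rw [Submodule.mem_colon_singleton, Submodule.mem_bot, sub_smul, one_smul, sub_eq_zero]
      exact hr.symm)
    have h2 : (r : C) ∈ m ⟨P, hP⟩ := by
      have := congrFun ((RingHom.mem_ker).mp r.2) ⟨P, hP⟩
      exact Ideal.Quotient.eq_zero_iff_mem.mp this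
    refine (hmax ⟨P, hP⟩).ne_top ((Ideal.eq_top_iff_one _).mpr ?_)
    simpa using add_mem (hle ⟨P, hP⟩ h1) h2

/-! ### Ideals of finite index in finitely generated rings

Two-sided ideals are encoded as additive subgroups, in the form `Submodule ℤ A`, for which products
and powers are available over a noncommutative ring. -/

section

open Submodule

theorem finite_nonUnitalRingHom (A R : Type*) [Ring A] [NonUnitalRing R] [Finite R]
    [hA : Algebra.FiniteType ℤ A] : Finite (A →ₙ+* R) := by
  obtain ⟨S, hS⟩ := hA.out
  refine Finite.of_injective
    (fun f : A →ₙ+* R => (f 1, fun s : S => f s)) fun f g hfg => ?_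
  simp only [Prod.mk.injEq] at hfg
  obtain ⟨h1, h2⟩ := hfg
  ext a
  have ha : a ∈ Algebra.adjoin ℤ (S : Set A) := hS ▸ Algebra.mem_top
  induction ha using Algebra.adjoin_induction with
  | mem x hx => exact congrFun h2 ⟨x, hx⟩
  | algebraMap r => rw [Algebra.algebraMap_eq_smul_one, map_zsmul, map_zsmul, h1]
  | add x y _ _ hx hy => simp [hx, hy]
  | mul x y _ _ hx hy => simp [hx, hy]

/-- If the additive group of `A ⧸ I` is finitely generated, then so is that of `A ⧸ I * I`. -/
theorem fg_quotient_mul_self {A : Type*} [Ring A] [hA : Algebra.FiniteType ℤ A]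
    (I : Submodule ℤ A) (hl : ⊤ * I ≤ I) [Module.Finite ℤ (A ⧸ I)] :
    Module.Finite ℤ (A ⧸ I * I) := by
  obtain ⟨S, hS⟩ := hA.out
  -- `M` is a finitely generated additive subgroup that contains generators and maps onto `A ⧸ I`.
  obtain ⟨M, hM, h1M, hSM, hMI⟩ : ∃ M : Submodule ℤ A, M.FG ∧ (1 : A) ∈ M ∧ (S : Set A) ⊆ M ∧
      M ⊔ I = ⊤ := by
    obtain ⟨M₀, hM₀, hM₀I⟩ : ∃ M₀ : Submodule ℤ A, M₀.FG ∧ M₀ ⊔ I = ⊤ := by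
      obtain ⟨T, hT⟩ := (Module.Finite.fg_top : (⊤ : Submodule ℤ (A ⧸ I)).FG)
      refine ⟨span ℤ (Quotient.out '' (T : Set (A ⧸ I))), fg_span (T.finite_toSet.image _), ?_⟩
      have himage : I.mkQ '' (Quotient.out '' (T : Set (A ⧸ I))) = T := by
        rw [Set.image_image]
        exact (Set.image_congr fun x _ => Quotient.out_eq x).trans (Set.image_id' _)
      rw [sup_comm, ← comap_map_mkQ, map_span, himage, hT, comap_top]
    refine ⟨M₀ ⊔ span ℤ (insert 1 (S : Set A)), hM₀.sup (fg_span (S.finite_toSet.insert 1)),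
      mem_sup_right (subset_span (Set.mem_insert _ _)),
      fun x hx => mem_sup_right (subset_span (Set.mem_insert_of_mem _ hx)), ?_⟩
    rw [eq_top_iff, ← hM₀I]
    exact sup_le_sup_right le_sup_left _
  -- The elements of `F` measure the failure of `M` to be closed under multiplication modulo `I * I`.
  set F := M * M ⊓ I with hF
  have hFI : F ≤ I := inf_le_right
  have hFfg : F.FG := FG.of_le (hM.mul hM) inf_le_left
  have hMM : M * M ≤ M ⊔ F := by
    intro x hx
    obtain ⟨m, hm, i, hi, rfl⟩ := mem_sup.mp (hMI ▸ mem_top : x ∈ M ⊔ I)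
    refine add_mem (mem_sup_left hm) (mem_sup_right ⟨?_, hi⟩)
    have : m ∈ M * M := by
      have := mul_mem_mul h1M hm
      rwa [one_mul] at this
    simpa using sub_mem hx this
  -- `B` contains `1` and is stable under left multiplication by the generators, so it is all of `A`.
  set B := M ⊔ M * F ⊔ I * I with hB
  have hFB : F ≤ M * F := by
    conv_lhs => rw [← one_mul F]
    exact mul_le_mul_left (one_le.mpr h1M) F
  have hMB : M * B ≤ B := by
    have e1 : M * M ≤ B := (hMM.trans (sup_le_sup_left hFB _)).trans le_sup_left
    have e2 : M * (M * F) ≤ B := by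
      rw [← mul_assoc]
      refine (mul_le_mul_left hMM F).trans ?_
      rw [Submodule.sup_mul]
      exact sup_le (le_sup_right.trans le_sup_left) ((mul_le_mul' hFI hFI).trans le_sup_right)
    have e3 : M * (I * I) ≤ B := by
      rw [← mul_assoc]
      exact (mul_le_mul_left ((mul_le_mul_left le_top I).trans hl) I).trans le_sup_right
    rw [hB, Submodule.mul_sup, Submodule.mul_sup]
    exact sup_le (sup_le e1 e2) e3
  have hBtop : B = ⊤ := by
    rw [eq_top_iff]
    have key : ∀ a : A, ∀ b ∈ B, a * b ∈ B := by
      intro a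
      have ha : a ∈ Algebra.adjoin ℤ (S : Set A) := hS ▸ Algebra.mem_top
      induction ha using Algebra.adjoin_induction with
      | mem x hx => exact fun b hb => hMB (mul_mem_mul (hSM hx) hb)
      | algebraMap r =>
        intro b hb
        rw [← Algebra.smul_def]
        exact B.smul_mem r hb
      | add x y _ _ hx hy =>
        intro b hb
        rw [add_mul]
        exact add_mem (hx b hb) (hy b hb)
      | mul x y _ _ hx hy =>
        intro b hb
        rw [mul_assoc]
        exact hx _ (hy b hb)
    intro a _
    simpa using key a 1 (mem_sup_left (mem_sup_left h1M))
  have hfg : (M ⊔ M * F).FG := hM.sup (hM.mul hFfg)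
  refine ⟨?_⟩
  have : (⊤ : Submodule ℤ (A ⧸ I * I)) = (M ⊔ M * F).map (I * I).mkQ := by
    rw [← range_mkQ, ← Submodule.map_top, ← hBtop, hB, Submodule.map_sup]
    simp
  rw [this]
  exact hfg.map _

/-! ### Automorphisms acting trivially modulo the square of an ideal -/

/-- An automorphism that is trivial modulo `I * I` is trivial on the factors `I ^ k ⧸ I ^ (k + 1)`.
Triviality modulo `I` alone would not suffice. -/
theorem smul_sub_mem_pow_succ {G A : Type*} [Group G] [Ring A] [MulSemiringAction G A]
    {I : Submodule ℤ A} (hl : ⊤ * I ≤ I) {g : G} (hg : ∀ a : A, g • a - a ∈ I * I)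
    (k : ℕ) {x : A} (hx : x ∈ I ^ (k + 1)) : g • x - x ∈ I ^ (k + 2) := by
  have hII : I * I ≤ I := (mul_le_mul_left le_top I).trans hl
  induction k generalizing x with
  | zero => rw [zero_add, pow_two]; exact hg x
  | succ k ih =>
    rw [pow_succ] at hx
    induction hx using Submodule.mul_induction_on' with
    | mem_mul_mem y hy z hz =>
      have hgz : g • z ∈ I := by simpa using add_mem (hII (hg z)) hz
      have e : g • (y * z) - y * z = (g • y - y) * (g • z) + y * (g • z - z) := by
        rw [smul_mul']; noncomm_ring
      rw [e]
      refine add_mem ?_ ?_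
      · rw [pow_succ]; exact mul_mem_mul (ih hy) hgz
      · rw [show k + 1 + 2 = (k + 1) + 1 + 1 from rfl, pow_succ, pow_succ, mul_assoc]
        exact mul_mem_mul hy (hg z)
    | add y _ z _ hy hz =>
      rw [smul_add, add_sub_add_comm]
      exact add_mem hy hz

/-- An automorphism of order dividing `p` that is trivial modulo `I * I` is trivial modulo all powers
of `I`, if `I` contains an integer prime to `p`. The exponent starts at `1` because
`I ^ 0 : Submodule ℤ A` is the image of `ℤ`, not `⊤`. -/
theorem smul_sub_mem_pow_of_pow_eq_one {G A : Type*} [Group G] [Ring A] [MulSemiringAction G A]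
    {I : Submodule ℤ A} (hl : ⊤ * I ≤ I) (hr : I * ⊤ ≤ I) {l p : ℕ} (hlI : (l : A) ∈ I)
    (hpl : p.Coprime l) {g : G} (hg : ∀ a : A, g • a - a ∈ I * I) (hgp : g ^ p = 1)
    (k : ℕ) (a : A) : g • a - a ∈ I ^ (k + 1) := by
  induction k with
  | zero =>
    rw [zero_add, pow_one]
    exact (mul_le_mul_left le_top I).trans hl (hg a)
  | succ k ih =>
    set d := g • a - a with hd
    -- `g` fixes `d` modulo `I ^ (k + 2)`, so iterating `g` on `a` adds `d` each time.
    have hiter : ∀ j : ℕ, g ^ j • a - a - j • d ∈ I ^ (k + 2) := by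
      intro j
      induction j with
      | zero => simp
      | succ j hj =>
        have hgd : g • ((g ^ j • a - a - j • d) + j • d) - ((g ^ j • a - a - j • d) + j • d)
            ∈ I ^ (k + 2) := by
          refine smul_sub_mem_pow_succ hl hg k (add_mem ?_ (Submodule.smul_of_tower_mem _ j ih))
          have : I ^ (k + 2) ≤ I ^ (k + 1) := by
            rw [pow_succ _ (k + 1), pow_succ, mul_assoc]
            exact mul_le_mul_right ((mul_le_mul_left le_top I).trans hl) _
          exact this hj
        have e : g ^ (j + 1) • a - a - (j + 1) • d =
            (g • ((g ^ j • a - a - j • d) + j • d) - ((g ^ j • a - a - j • d) + j • d)) +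
              (g ^ j • a - a - j • d) := by
          rw [sub_add_cancel, smul_sub g, smul_smul g, ← pow_succ', succ_nsmul, hd]
          abel
        rw [e]
        exact add_mem hgd hj
    have hp : (p : ℤ) • d ∈ I ^ (k + 2) := by
      have := hiter p
      rw [hgp, one_smul, sub_self, zero_sub] at this
      simpa using neg_mem this
    have hl' : ((l ^ (k + 2) : ℕ) : ℤ) • d ∈ I ^ (k + 2) := by
      have h : (l : A) ^ (k + 2) * d ∈ I ^ (k + 2) * ⊤ := mul_mem_mul (pow_mem_pow _ hlI _) mem_top
      have hle : I ^ (k + 2) * ⊤ ≤ I ^ (k + 2) := by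
        rw [pow_succ, mul_assoc]
        exact mul_le_mul_right hr _
      simpa using hle h
    obtain ⟨u, v, huv⟩ := Nat.isCoprime_iff_coprime.mpr (hpl.pow_right (k + 2))
    have : d = u • ((p : ℤ) • d) + v • (((l ^ (k + 2) : ℕ) : ℤ) • d) := by
      rw [smul_smul, smul_smul, ← add_smul, huv, one_smul]
    rw [this]
    exact add_mem ((I ^ (k + 2)).smul_mem u hp) ((I ^ (k + 2)).smul_mem v hl')

theorem exists_finiteIndex_smul_sub_mem {G A : Type*} [Group G] [Ring A] [MulSemiringAction G A]
    (N : Submodule ℤ A) [Finite (A ⧸ N)] (hN : ∀ (g : G), ∀ x ∈ N, g • x ∈ N) :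
    ∃ K : Subgroup G, K.FiniteIndex ∧ ∀ g ∈ K, ∀ a : A, g • a - a ∈ N := by
  let φ : G →* Module.End ℤ (A ⧸ N) :=
    { toFun g := N.mapQ N (DistribSMul.toAddMonoidHom A g).toIntLinearMap (hN g)
      map_one' := by
        ext a
        exact congrArg N.mkQ (one_smul G a)
      map_mul' g h := by
        ext a
        exact congrArg N.mkQ (mul_smul g h a) }
  have : Finite (Module.End ℤ (A ⧸ N)) := Finite.of_injective _ DFunLike.coe_injective
  refine ⟨φ.toHomUnits.ker, inferInstance, fun g hg a => ?_⟩
  have h : φ g = 1 := congrArg Units.val (MonoidHom.mem_ker.mp hg)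
  have := LinearMap.congr_fun h (N.mkQ a)
  exact (Submodule.Quotient.eq N).mp this

/-- If `A` embeds in matrices over `C`, and `C` is separated in the adic topology of the kernel of a
homomorphism to a finite ring in which `l = 0`, then `G` has a subgroup of finite index without
torsion of order prime to `l`. -/
theorem exists_finiteIndex_pow_eq_one {G A R C ι : Type*} [Group G] [Ring A] [MulSemiringAction G A]
    [FaithfulSMul G A] [Algebra.FiniteType ℤ A] [CommRing C] [CommRing R] [Finite R] [Fintype ι]
    [DecidableEq ι] {f : A →ₙ+* Matrix ι ι C} (hf : Function.Injective f) {q : C →+* R}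
    (hq : ⨅ k : ℕ, RingHom.ker q ^ k = ⊥) {l : ℕ} (hl0 : l ≠ 0) (hlR : (l : R) = 0) :
    ∃ K : Subgroup G, K.FiniteIndex ∧ ∀ g ∈ K, ∀ p : ℕ, p.Coprime l → g ^ p = 1 → g = 1 := by
  have := finite_nonUnitalRingHom A (Matrix ι ι R)
  -- The intersection of the kernels of all homomorphisms to matrices over `R`.
  let φ : A →ₗ[ℤ] ((A →ₙ+* Matrix ι ι R) → Matrix ι ι R) :=
    LinearMap.pi fun h => (h : A →+ Matrix ι ι R).toIntLinearMap
  set I := LinearMap.ker φ with hI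
  have memI : ∀ x, x ∈ I ↔ ∀ h : A →ₙ+* Matrix ι ι R, h x = 0 := fun x => funext_iff
  have hl : ⊤ * I ≤ I := mul_le.mpr fun a _ x hx => (memI _).mpr fun h => by
    rw [map_mul, (memI x).mp hx, mul_zero]
  have hr : I * ⊤ ≤ I := mul_le.mpr fun x hx a _ => (memI _).mpr fun h => by
    rw [map_mul, (memI x).mp hx, zero_mul]
  have hGI : ∀ (g : G), ∀ x ∈ I, g • x ∈ I := fun g x hx => (memI _).mpr fun h =>
    (memI x).mp hx (h.comp (MulSemiringAction.toRingHom G A g : A →ₙ+* A))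
  have hlI : (l : A) ∈ I := (memI _).mpr fun h => by
    have h0 : (l : Matrix ι ι R) = 0 := by
      rw [← map_natCast (algebraMap R (Matrix ι ι R)), hlR, map_zero]
    rw [← nsmul_one, map_nsmul, nsmul_eq_mul, h0, zero_mul]
  have hfinI : Finite (A ⧸ I) := Finite.of_injective (I.liftQ φ le_rfl)
    (LinearMap.ker_eq_bot.mp (ker_liftQ_eq_bot _ _ _ le_rfl))
  have hfgII : Module.Finite ℤ (A ⧸ I * I) := fg_quotient_mul_self I hl
  have hfinII : Finite (A ⧸ I * I) := by
    refine Module.finite_of_fg_torsion _ fun {x} => ?_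
    obtain ⟨a, rfl⟩ := (I * I).mkQ_surjective x
    refine ⟨⟨(l ^ 2 : ℕ), mem_nonZeroDivisors_of_ne_zero (by exact_mod_cast pow_ne_zero 2 hl0)⟩, ?_⟩
    have h : (l : A) * ((l : A) * a) ∈ I * I :=
      mul_mem_mul hlI (hr (mul_mem_mul hlI mem_top))
    change ((l ^ 2 : ℕ) : ℤ) • (I * I).mkQ a = 0
    rw [← map_smul, mkQ_apply, Quotient.mk_eq_zero]
    simpa [pow_two, mul_assoc] using h
  have hGII : ∀ (g : G), ∀ x ∈ I * I, g • x ∈ I * I := by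
    intro g x hx
    induction hx using Submodule.mul_induction_on' with
    | mem_mul_mem y hy z hz => rw [smul_mul']; exact mul_mem_mul (hGI g y hy) (hGI g z hz)
    | add y _ z _ hy hz => rw [smul_add]; exact add_mem hy hz
  -- `I` maps into the matrices over `ker q`, because `f` followed by reduction to `R` is one of the
  -- homomorphisms defining `I`.
  have hpow : ∀ (k : ℕ), ∀ x ∈ I ^ k, ∀ i j, f x i j ∈ RingHom.ker q ^ k := by
    intro k
    induction k with
    | zero => simp
    | succ k ih =>
      intro x hx i j
      rw [pow_succ] at hx
      induction hx using Submodule.mul_induction_on' with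
      | mem_mul_mem y hy z hz =>
        rw [map_mul, Matrix.mul_apply, pow_succ]
        refine sum_mem fun t _ => Ideal.mul_mem_mul (ih y hy i t) ?_
        have := (memI z).mp hz
          ((q.mapMatrix : Matrix ι ι C →+* Matrix ι ι R).toNonUnitalRingHom.comp f)
        exact congrFun (congrFun this t) j
      | add y _ z _ hy hz =>
        rw [map_add, Matrix.add_apply]
        exact add_mem hy hz
  obtain ⟨K, hK, hKI⟩ := exists_finiteIndex_smul_sub_mem (I * I) hGII
  refine ⟨K, hK, fun g hg p hp hgp => FaithfulSMul.eq_of_smul_eq_smul (α := A) fun a => ?_⟩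
  rw [one_smul, ← sub_eq_zero]
  refine (map_eq_zero_iff f hf).mp (Matrix.ext fun i j => ?_)
  have h : f (g • a - a) i j ∈ ⨅ k : ℕ, RingHom.ker q ^ k := by
    refine Submodule.mem_iInf _ |>.mpr fun k => Ideal.pow_le_pow_right k.le_succ ?_
    exact hpow _ _ (smul_sub_mem_pow_of_pow_eq_one hl hr hlI hp (hKI g hg) hgp k a) i j
  rw [hq] at h
  exact h

end

/-! ### Groups acting on representable rings -/

theorem isVirtuallyTorsionFree_of_two_subgroups {G : Type*} [Group G] {l₁ l₂ : ℕ} (h₁ : l₁.Prime)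
    (h₂ : l₂.Prime) (hne : l₁ ≠ l₂) {K₁ K₂ : Subgroup G} [K₁.FiniteIndex] [K₂.FiniteIndex]
    (hK₁ : ∀ g ∈ K₁, ∀ p : ℕ, p.Coprime l₁ → g ^ p = 1 → g = 1)
    (hK₂ : ∀ g ∈ K₂, ∀ p : ℕ, p.Coprime l₂ → g ^ p = 1 → g = 1) : IsVirtuallyTorsionFree G := by
  refine ⟨K₁ ⊓ K₂, inferInstance, fun g hg hfin => ?_⟩
  by_contra hg1
  have hn : orderOf g ≠ 1 := fun h => hg1 (orderOf_eq_one_iff.mp h)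
  set p := (orderOf g).minFac with hp
  have hpp : p.Prime := Nat.minFac_prime hn
  have hgp : (g ^ (orderOf g / p)) ^ p = 1 := by
    rw [← pow_mul, Nat.div_mul_cancel (Nat.minFac_dvd _), pow_orderOf_eq_one]
  have hne1 : g ^ (orderOf g / p) ≠ 1 :=
    pow_ne_one_of_lt_orderOf
      (Nat.div_pos (Nat.minFac_le hfin.orderOf_pos) hpp.pos).ne'
      (Nat.div_lt_self hfin.orderOf_pos hpp.one_lt)
  by_cases hpl : p = l₁
  · exact hne1 (hK₂ _ (pow_mem hg.2 _) p
      ((Nat.coprime_primes hpp h₂).mpr (hpl ▸ hne)) hgp)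
  · exact hne1 (hK₁ _ (pow_mem hg.1 _) p ((Nat.coprime_primes hpp h₁).mpr hpl) hgp)

theorem isVirtuallyTorsionFree_of_matrix_of_finiteType {G A ι : Type*} {C : Type w} [Group G]
    [Ring A] [MulSemiringAction G A] [FaithfulSMul G A] [Algebra.FiniteType ℤ A] [CommRing C]
    [Algebra.FiniteType ℤ C] [IsAddTorsionFree C] [Fintype ι] [DecidableEq ι]
    {f : A →ₙ+* Matrix ι ι C} (hf : Function.Injective f) : IsVirtuallyTorsionFree G := by
  obtain ⟨N, hN, h⟩ := exists_finite_quotient_iInf_pow_ker_eq_bot C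
  have key : ∀ l : ℕ, l.Prime → N.natAbs < l → ∃ K : Subgroup G, K.FiniteIndex ∧
      ∀ g ∈ K, ∀ p : ℕ, p.Coprime l → g ^ p = 1 → g = 1 := by
    intro l hl hlN
    obtain ⟨R, _, q, _, hlR, hq⟩ := h l hl fun hdvd =>
      (Nat.le_of_dvd (Int.natAbs_pos.mpr hN) (Int.natCast_dvd.mp hdvd)).not_gt hlN
    exact exists_finiteIndex_pow_eq_one hf hq hl.ne_zero hlR
  obtain ⟨l₁, hlt₁, hl₁⟩ := Nat.exists_infinite_primes (N.natAbs + 1)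
  obtain ⟨l₂, hlt₂, hl₂⟩ := Nat.exists_infinite_primes (l₁ + 1)
  obtain ⟨K₁, _, hK₁⟩ := key l₁ hl₁ (by omega)
  obtain ⟨K₂, _, hK₂⟩ := key l₂ hl₂ (by omega)
  exact isVirtuallyTorsionFree_of_two_subgroups hl₁ hl₂ (by omega) hK₁ hK₂

/-- The coefficient ring of a matrix embedding of a torsion-free ring can be localized at the nonzero
integers: an element of the kernel would be killed by a common denominator of its entries. -/
theorem exists_matrix_injective_isAddTorsionFree {A ι : Type*} {C : Type w} [Ring A]
    [IsAddTorsionFree A] [CommRing C] [Fintype ι] [DecidableEq ι] {f : A →ₙ+* Matrix ι ι C}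
    (hf : Function.Injective f) : ∃ (L : Type w) (_ : CommRing L) (f' : A →ₙ+* Matrix ι ι L),
      IsAddTorsionFree L ∧ Function.Injective f' := by
  let S := Algebra.algebraMapSubmonoid C (nonZeroDivisors ℤ)
  let q := algebraMap C (Localization S)
  refine ⟨Localization S, inferInstance,
    (q.mapMatrix : Matrix ι ι C →+* Matrix ι ι (Localization S)).toNonUnitalRingHom.comp f,
    ⟨fun n hn x y hxy => ?_⟩, ?_⟩
  · have hu : IsUnit (n : Localization S) := by
      have : (n : C) ∈ S := ⟨n, mem_nonZeroDivisors_of_ne_zero (by exact_mod_cast hn), by simp⟩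
      simpa [q] using IsLocalization.map_units (Localization S) ⟨_, this⟩
    simp only [nsmul_eq_mul] at hxy
    exact hu.mul_right_injective hxy
  · rw [injective_iff_map_eq_zero]
    intro a ha
    have hentry : ∀ i j, ∃ m : ℤ, m ≠ 0 ∧ m • f a i j = 0 := by
      intro i j
      have h0 : q (f a i j) = 0 := congrFun (congrFun ha i) j
      obtain ⟨⟨_, m, hm, rfl⟩, h⟩ := (IsLocalization.map_eq_zero_iff S (Localization S) _).mp h0
      exact ⟨m, nonZeroDivisors.ne_zero hm, by simpa using h⟩
    choose m hm h using hentry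
    have hprod : (∏ t : ι × ι, m t.1 t.2) • a = 0 := by
      refine (map_eq_zero_iff f hf).mp (Matrix.ext fun i j => ?_)
      rw [map_zsmul, Matrix.smul_apply, ← Finset.prod_erase_mul _ _ (Finset.mem_univ (i, j)),
        mul_smul, h, smul_zero, Matrix.zero_apply]
    exact (IsAddTorsionFree.zsmul_eq_zero_iff_right
      (Finset.prod_ne_zero_iff.mpr fun t _ => hm t.1 t.2)).mp hprod

theorem exists_matrix_injective_finiteType {A ι : Type*} {C : Type w} [Ring A]
    [hA : Algebra.FiniteType ℤ A] [CommRing C] [Fintype ι] {f : A →ₙ+* Matrix ι ι C}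
    (hf : Function.Injective f) : ∃ (D : Subalgebra ℤ C) (f' : A →ₙ+* Matrix ι ι D),
      Algebra.FiniteType ℤ D ∧ Function.Injective f' := by
  obtain ⟨S, hS⟩ := hA.out
  -- The matrix of `1` is included since `f` need not be unital.
  let T : Set C := ⋃ s ∈ insert 1 (S : Set A), ⋃ i, ⋃ j, {f s i j}
  have hTfin : T.Finite := (S.finite_toSet.insert 1).biUnion fun s _ =>
    Set.finite_iUnion fun i => Set.finite_iUnion fun j => Set.finite_singleton _
  have hT : ∀ s ∈ insert 1 (S : Set A), ∀ i j, f s i j ∈ Algebra.adjoin ℤ T := fun s hs i j =>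
    Algebra.subset_adjoin (Set.mem_biUnion hs (Set.mem_iUnion₂.mpr ⟨i, j, rfl⟩))
  set D := Algebra.adjoin ℤ T with hD
  have hfD : ∀ a i j, f a i j ∈ D := by
    intro a
    have ha : a ∈ Algebra.adjoin ℤ (S : Set A) := hS ▸ Algebra.mem_top
    induction ha using Algebra.adjoin_induction with
    | mem x hx => exact hT x (Set.mem_insert_of_mem _ hx)
    | algebraMap r =>
      intro i j
      rw [Algebra.algebraMap_eq_smul_one, map_zsmul, Matrix.smul_apply]
      exact zsmul_mem (hT 1 (Set.mem_insert _ _) i j) r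
    | add x y _ _ hx hy =>
      intro i j
      rw [map_add]
      exact add_mem (hx i j) (hy i j)
    | mul x y _ _ hx hy =>
      intro i j
      rw [map_mul, Matrix.mul_apply]
      exact sum_mem fun k _ => mul_mem (hx i k) (hy k j)
  let f' : A →ₙ+* Matrix ι ι D :=
    { toFun a := Matrix.of fun i j => ⟨f a i j, hfD a i j⟩
      map_zero' := by ext; simp
      map_add' x y := by ext; simp
      map_mul' x y := by ext; simp [Matrix.mul_apply] }
  refine ⟨D, f', (Subalgebra.fg_iff_finiteType D).mp ⟨hTfin.toFinset, by simp [hD]⟩,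
    fun x y hxy => hf (Matrix.ext fun i j => ?_)⟩
  exact congrArg Subtype.val (congrFun (congrFun hxy i) j)

theorem isVirtuallyTorsionFree_of_matrix {G A ι : Type*} {C : Type w} [Group G] [Ring A]
    [MulSemiringAction G A] [FaithfulSMul G A] [Algebra.FiniteType ℤ A] [IsAddTorsionFree A]
    [CommRing C] [Fintype ι] [DecidableEq ι] {f : A →ₙ+* Matrix ι ι C}
    (hf : Function.Injective f) : IsVirtuallyTorsionFree G := by
  obtain ⟨L, _, f', _, hf'⟩ := exists_matrix_injective_isAddTorsionFree hf
  obtain ⟨D, f'', _, hf''⟩ := exists_matrix_injective_finiteType hf'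
  have : IsAddTorsionFree D :=
    ⟨fun n hn x y hxy => Subtype.ext (nsmul_right_injective hn (congrArg Subtype.val hxy))⟩
  exact isVirtuallyTorsionFree_of_matrix_of_finiteType hf''

/-! ### Descent to a finitely generated subring -/

/-- An element of the algebra generated by `S` involves only finitely many coefficients. -/
theorem exists_finite_mem_adjoin_int {Φ A : Type*} [CommRing Φ] [Ring A] [Algebra Φ A] {S : Set A}
    {a : A} (ha : a ∈ Algebra.adjoin Φ S) :
    ∃ E : Set Φ, E.Finite ∧ a ∈ Algebra.adjoin ℤ (S ∪ algebraMap Φ A '' E) := by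
  have mono : ∀ {E F : Set Φ}, E ⊆ F → Algebra.adjoin ℤ (S ∪ algebraMap Φ A '' E) ≤
      Algebra.adjoin ℤ (S ∪ algebraMap Φ A '' F) := fun h =>
    Algebra.adjoin_mono (Set.union_subset_union_right _ (Set.image_mono h))
  induction ha using Algebra.adjoin_induction with
  | mem x hx => exact ⟨∅, Set.finite_empty, Algebra.subset_adjoin (Or.inl hx)⟩
  | algebraMap r =>
    exact ⟨{r}, Set.finite_singleton r, Algebra.subset_adjoin (Or.inr ⟨r, rfl, rfl⟩)⟩
  | add x y _ _ hx hy =>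
    obtain ⟨E, hE, hx⟩ := hx
    obtain ⟨F, hF, hy⟩ := hy
    exact ⟨E ∪ F, hE.union hF,
      add_mem (mono Set.subset_union_left hx) (mono Set.subset_union_right hy)⟩
  | mul x y _ _ hx hy =>
    obtain ⟨E, hE, hx⟩ := hx
    obtain ⟨F, hF, hy⟩ := hy
    exact ⟨E ∪ F, hE.union hF,
      mul_mem (mono Set.subset_union_left hx) (mono Set.subset_union_right hy)⟩

theorem exists_invariant_finiteType_subring {Φ A : Type*} [CommRing Φ] [Ring A] [Algebra Φ A]
    [hA : Algebra.FiniteType Φ A] (H : Subgroup (A ≃ₐ[Φ] A)) (hH : H.FG) :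
    ∃ A₀ : Subalgebra ℤ A, Algebra.FiniteType ℤ A₀ ∧ (∀ h ∈ H, ∀ a ∈ A₀, h a ∈ A₀) ∧
      Algebra.adjoin Φ (A₀ : Set A) = ⊤ := by
  obtain ⟨S, hS⟩ := hA.out
  obtain ⟨T, hT, hTfin⟩ := (Subgroup.fg_iff _).mp hH
  have hmem : ∀ a : A, a ∈ Algebra.adjoin Φ (S : Set A) := fun a => hS ▸ Algebra.mem_top
  choose E hE hES using fun a => exists_finite_mem_adjoin_int (hmem a)
  -- Inverses are included so that `H` is generated by `T'` as a monoid.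
  let T' : Set (A ≃ₐ[Φ] A) := T ∪ T⁻¹
  have hT'fin : T'.Finite := hTfin.union hTfin.inv
  let F : Set Φ := ⋃ h ∈ T', ⋃ s ∈ (S : Set A), E (h s)
  have hEF : ∀ h ∈ T', ∀ s ∈ (S : Set A), E (h s) ⊆ F := fun h hh s hs r hr =>
    Set.mem_biUnion hh (Set.mem_biUnion hs hr)
  have hF : F.Finite := hT'fin.biUnion fun h _ => S.finite_toSet.biUnion fun s _ => hE _
  clear_value F
  set U : Set A := S ∪ algebraMap Φ A '' F with hUdef
  have hU : U.Finite := S.finite_toSet.union (hF.image _)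
  have hgen : ∀ h ∈ T', ∀ a ∈ Algebra.adjoin ℤ U, h a ∈ Algebra.adjoin ℤ U := by
    intro h hh a ha
    induction ha using Algebra.adjoin_induction with
    | mem x hx =>
      rcases hx with hx | ⟨r, hr, rfl⟩
      · exact Algebra.adjoin_mono
          (Set.union_subset_union_right _ (Set.image_mono (hEF h hh x hx))) (hES (h x))
      · rw [AlgEquiv.commutes]
        exact Algebra.subset_adjoin (Or.inr ⟨r, hr, rfl⟩)
    | algebraMap r =>
      rw [eq_intCast (algebraMap ℤ A), map_intCast]
      exact intCast_mem _ r
    | add x y _ _ hx hy => rw [map_add]; exact add_mem hx hy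
    | mul x y _ _ hx hy => rw [map_mul]; exact mul_mem hx hy
  refine ⟨Algebra.adjoin ℤ U, (Subalgebra.fg_iff_finiteType _).mp ⟨hU.toFinset, by simp⟩, ?_, ?_⟩
  · intro h hh
    rw [← hT, ← Subgroup.mem_toSubmonoid, Subgroup.closure_toSubmonoid] at hh
    induction hh using Submonoid.closure_induction with
    | mem x hx => exact hgen x hx
    | one => exact fun a ha => ha
    | mul x y _ _ hx hy => exact fun a ha => hx _ (hy a ha)
  · rw [eq_top_iff, ← hS]
    exact Algebra.adjoin_mono fun s hs => Algebra.subset_adjoin (Or.inl hs)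

theorem theorem4 {Φ : Type u} {A : Type v} [CommRing Φ] [Ring A] [Algebra Φ A]
    (hfg : Algebra.FiniteType Φ A) (hPI : IsPIAlgebra Φ A)
    (hrep : IsRepresentable.{u, v, w} Φ A) (htf : IsAddTorsionFree A) :
    (∀ H : Subgroup (A ≃ₐ[Φ] A), H.FG → IsVirtuallyTorsionFree H) ∧
      (Algebra.FiniteType ℤ A → IsVirtuallyTorsionFree (RingAut A)) := by
  obtain ⟨C, _, _, n, f, hf⟩ := hrep
  let f₀ : A →ₙ+* Matrix (Fin n) (Fin n) C := f
  have hf₀ : Function.Injective f₀ := hf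
  refine ⟨fun H hH => ?_, fun _ => isVirtuallyTorsionFree_of_matrix hf₀⟩
  obtain ⟨A₀, _, hinv, hgen⟩ := exists_invariant_finiteType_subring H hH
  have : IsAddTorsionFree A₀ :=
    ⟨fun n hn x y hxy => Subtype.ext (nsmul_right_injective hn (congrArg Subtype.val hxy))⟩
  let _ : MulSemiringAction H A₀ :=
    { smul h a := ⟨h.1 a, hinv h h.2 a a.2⟩
      one_smul _ := rfl
      mul_smul _ _ _ := rfl
      smul_zero h := Subtype.ext (map_zero h.1)
      smul_add h x y := Subtype.ext (map_add h.1 x.1 y.1)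
      smul_one h := Subtype.ext (map_one h.1)
      smul_mul h x y := Subtype.ext (map_mul h.1 x.1 y.1) }
  have : FaithfulSMul H A₀ := by
    refine ⟨fun {h₁ h₂} heq => Subtype.ext (AlgEquiv.ext fun a => ?_)⟩
    exact DFunLike.congr_fun (AlgHom.ext_of_adjoin_eq_top (φ₁ := (h₁.1 : A →ₐ[Φ] A))
      (φ₂ := (h₂.1 : A →ₐ[Φ] A)) hgen fun x hx => congrArg Subtype.val (heq ⟨x, hx⟩)) a
  let g : A₀ →ₙ+* A := (A₀.val : A₀ →+* A).toNonUnitalRingHom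
  exact isVirtuallyTorsionFree_of_matrix (f := f₀.comp g) (hf₀.comp Subtype.val_injective)
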